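/- A morphism $N=(N_1,\dots,N_n):\mathbb C^n\to\mathbb C^n$ given by polynomials $N_i\in\mathbb C[X_1,\dots,X_n]$ is called nilpotent if its Jacobi matrix $JN(X)=\left(\partial N_i/\partial X_j\right)_{1\le i,j\le n}$ satisfies $(JN(X))^n=0$ as a matrix over $\mathbb C[X_1,\dots,X_n]$. Its polynomial degree is $\deg_p N=\max_i \deg N_i$, and a fixed point of $N$ is a point $x\in\mathbb C^n$ with $N(x)=x$. For each $n$, let $JN(n)$ be the assertion that every nilpotent morphism $N:\mathbb C^n\to\mathbb C^n$ has at most one fixed point. **Theorem.** Suppose that, for every $m$, each nilpotent morphism $N:\mathbb C^m\to\mathbb C^m$ of polynomial degree $\deg_p N=3$ has a unique fixed point. Then $JN(n)$ holds for all $n$. -/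

import Mathlib

/-- A morphism `ℂⁿ → ℂⁿ` of affine spaces, given by its `n` coordinate polynomials
in `n` variables. -/
abbrev AffineMorphism (n : ℕ) : Type := Fin n → MvPolynomial (Fin n) ℂ

namespace AffineMorphism

variable {n : ℕ}

/-- The self-map of `ℂⁿ` defined by the coordinate polynomials. -/
noncomputable def toMap (N : AffineMorphism n) (x : Fin n → ℂ) : Fin n → ℂ :=
  fun i => MvPolynomial.eval x (N i)

/-- The Jacobi matrix `(∂Nᵢ/∂Xⱼ)`, a matrix over the polynomial ring. -/
noncomputable def jacobian (N : AffineMorphism n) :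
    Matrix (Fin n) (Fin n) (MvPolynomial (Fin n) ℂ) :=
  Matrix.of fun i j => MvPolynomial.pderiv j (N i)

/-- A morphism is nilpotent if the `n`-th power of its Jacobi matrix vanishes identically. -/
def IsNilpotentMorphism (N : AffineMorphism n) : Prop :=
  N.jacobian ^ n = 0

/-- The polynomial degree: the maximum of the total degrees of the coordinate polynomials. -/
noncomputable def polyDegree (N : AffineMorphism n) : ℕ :=
  Finset.univ.sup fun i => (N i).totalDegree

end AffineMorphism

/-- Conjecture `JN(n)`: every nilpotent morphism `ℂⁿ → ℂⁿ` has at most one fixed point. -/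
def ConjectureJN (n : ℕ) : Prop :=
  ∀ N : AffineMorphism n, N.IsNilpotentMorphism →
    (Function.fixedPoints N.toMap).Subsingleton

/-! Two fixed points of a nilpotent `N` are two zeros of `X - N`, whose Jacobian determinant is 1;
so it suffices to turn any noninjective Keller map into a cubic nilpotent map with two fixed points.
Adding variables and composing with elementary automorphisms lowers the degree to 3 while keeping
determinant 1 and noninjectivity (`IsNoninjectiveKeller.exists_totalDegree_le`). A linear change
then gives `G = G₀ + x + G₂ + G₃` with `G₃ ≠ 0`. The map `(x, y) ↦ (y - G₂ x + c, -G₃ x)` has its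
fixed points exactly over the solutions of `G x = G₀ + c`, so a suitable `c` gives two of them.
Scaling `x` by `t⁻¹` shows that its Jacobi matrix has characteristic polynomial a power of `t`,
hence is nilpotent (`polyJacobian_quasihomogeneousMap_pow`). -/

open MvPolynomial

section PolynomialMaps

variable {σ ι : Type}

/-- The Jacobi matrix of a polynomial map indexed by an arbitrary finite type. -/
noncomputable def polyJacobian (F : σ → MvPolynomial σ ℂ) : Matrix σ σ (MvPolynomial σ ℂ) :=
  Matrix.of fun i j => pderiv j (F i)

/-- A polynomial map with Jacobian determinant `1` which is not injective. -/
def IsNoninjectiveKeller [Fintype σ] [DecidableEq σ] (F : σ → MvPolynomial σ ℂ) : Prop :=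
  (polyJacobian F).det = 1 ∧ ∃ a b : σ → ℂ, a ≠ b ∧ ∀ i, eval a (F i) = eval b (F i)

/-! ### Stabilisation by elementary automorphisms. -/

/-- The chain rule for a polynomial substitution. -/
theorem pderiv_bind₁_eq_sum [Fintype ι] {τ : Type} (g : ι → MvPolynomial τ ℂ) (j : τ) (q : MvPolynomial ι ℂ) :
    pderiv j (bind₁ g q) = ∑ k, bind₁ g (pderiv k q) * pderiv j (g k) := by
  classical
  induction q using MvPolynomial.induction_on with
  | C a => simp 
  | add p q hp hq => simp [hp, hq, add_mul, Finset.sum_add_distrib]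
  | mul_X p n hp =>
    simp only [map_mul, bind₁_X_right, pderiv_mul, hp, map_add, add_mul, Finset.sum_add_distrib,
      pderiv_X]
    congr 1
    · rw [Finset.sum_mul]
      exact Finset.sum_congr rfl fun k _ => by ring
    · rw [Finset.sum_eq_single n]
      · simp
      · intro k _ hk
        simp [hk.symm]
      · simp

/-- The stabilisation of `F` obtained by composing `F × id` with the elementary automorphisms
`(x, w) ↦ (x, w + S x)` and `(u, w) ↦ (u - q w, w)`. -/
noncomputable def elementaryExtension (F : σ → MvPolynomial σ ℂ) (S : ι → MvPolynomial σ ℂ)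
    (q : σ → MvPolynomial ι ℂ) : σ ⊕ ι → MvPolynomial (σ ⊕ ι) ℂ :=
  Sum.elim
    (fun i => rename Sum.inl (F i) - bind₁ (fun k => X (Sum.inr k) + rename Sum.inl (S k)) (q i))
    (fun k => X (Sum.inr k) + rename Sum.inl (S k))

theorem pderiv_inr_rename_inl (k : ι) (p : MvPolynomial σ ℂ) :
    pderiv (Sum.inr k) (rename (Sum.inl : σ → σ ⊕ ι) p) = 0 := by
  classical
  refine pderiv_eq_zero_of_notMem_vars fun h => ?_
  have := vars_rename Sum.inl p h
  simp at this

theorem pderiv_inl_rename_inl (j : σ) (p : MvPolynomial σ ℂ) :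
    pderiv (Sum.inl j) (rename (Sum.inl : σ → σ ⊕ ι) p) = rename Sum.inl (pderiv j p) :=
  pderiv_rename Sum.inl_injective j p

/-- The Jacobi matrix has blocks `A + B * D`, `B`, `D`, `1`, and the Schur complement of the block
`1` is `A`, the Jacobi matrix of `F`. -/
theorem det_polyJacobian_elementaryExtension [Fintype σ] [DecidableEq σ] [Fintype ι] [DecidableEq ι]
    (F : σ → MvPolynomial σ ℂ) (S : ι → MvPolynomial σ ℂ)
    (q : σ → MvPolynomial ι ℂ) :
    (polyJacobian (elementaryExtension F S q)).det = rename Sum.inl (polyJacobian F).det := by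
  set g : ι → MvPolynomial (σ ⊕ ι) ℂ := fun k => X (Sum.inr k) + rename Sum.inl (S k) with hg
  let B : Matrix σ ι (MvPolynomial (σ ⊕ ι) ℂ) :=
    Matrix.of fun i k => -bind₁ g (pderiv k (q i))
  let D : Matrix ι σ (MvPolynomial (σ ⊕ ι) ℂ) :=
    Matrix.of fun k j => rename Sum.inl (pderiv j (S k))
  let A : Matrix σ σ (MvPolynomial (σ ⊕ ι) ℂ) :=
    Matrix.of fun i j => rename Sum.inl (pderiv j (F i))
  have hJ : polyJacobian (elementaryExtension F S q) = Matrix.fromBlocks (A + B * D) B D 1 := by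
    ext1 i j
    rcases i with i | k <;> rcases j with j | l
    · simp [polyJacobian, elementaryExtension, pderiv_bind₁_eq_sum, A, B, D, Matrix.mul_apply,
        pderiv_inl_rename_inl, pderiv_X, hg, sub_eq_add_neg]
    · simp [polyJacobian, elementaryExtension, pderiv_bind₁_eq_sum, B,
        pderiv_inr_rename_inl, pderiv_X, Pi.single_apply, hg]
    · simp [polyJacobian, elementaryExtension, D, pderiv_inl_rename_inl, pderiv_X]
    · simp [polyJacobian, elementaryExtension, pderiv_inr_rename_inl, pderiv_X,
        Pi.single_apply, Matrix.one_apply]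
  rw [hJ, Matrix.det_fromBlocks_one₂₂, add_sub_cancel_right, AlgHom.map_det]
  rfl

theorem IsNoninjectiveKeller.elementaryExtension [Fintype σ] [DecidableEq σ] [Fintype ι]
    [DecidableEq ι] {F : σ → MvPolynomial σ ℂ}
    (hF : IsNoninjectiveKeller F) (S : ι → MvPolynomial σ ℂ) (q : σ → MvPolynomial ι ℂ) :
    IsNoninjectiveKeller (elementaryExtension F S q) := by
  obtain ⟨hdet, a, b, hab, h⟩ := hF
  refine ⟨by rw [det_polyJacobian_elementaryExtension, hdet, map_one],
    -- Lifting by `w = -S x` makes `w + S x` vanish, so the subtracted term is `q 0` at both points.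
    Sum.elim a fun k => -eval a (S k), Sum.elim b fun k => -eval b (S k), fun hne => hab ?_, ?_⟩
  · funext i
    exact congrFun hne (Sum.inl i)
  · have key (c : σ → ℂ) (p : MvPolynomial ι ℂ) :
        eval (Sum.elim c fun k => -eval c (S k))
          (bind₁ (fun k => X (Sum.inr k) + rename Sum.inl (S k)) p) = eval 0 p := by
      rw [eval, eval, eval₂Hom_bind₁]
      congr 2
      funext k
      change eval _ _ = _
      simp [eval_rename, Sum.elim_comp_inl]
    rintro (i | k)
    · simp only [_root_.elementaryExtension, Sum.elim_inl, map_sub, key, eval_rename,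
        Sum.elim_comp_inl, h i]
    · simp [_root_.elementaryExtension, eval_rename, Sum.elim_comp_inl]

/-! ### Reduction to degree 3. -/

/-- A polynomial of degree at most `d + 1`, where `1 ≤ d`, is a combination of products of two
variables, with coefficients of degree less than `d`, up to terms of degree at most `d`. -/
theorem exists_eq_add_sum_X_mul_X_mul [Fintype σ] {d : ℕ} (hd : 1 ≤ d) (p : MvPolynomial σ ℂ)
    (hp : p.totalDegree ≤ d + 1) :
    ∃ (R : MvPolynomial σ ℂ) (Q : σ × σ → MvPolynomial σ ℂ), R.totalDegree ≤ d ∧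
      (∀ k, (Q k).totalDegree + 1 ≤ d) ∧ p = R + ∑ k, X k.1 * X k.2 * Q k := by
  classical
  rw [p.as_sum]
  refine Finset.sum_induction _ (fun p => ∃ (R : MvPolynomial σ ℂ) (Q : σ × σ → MvPolynomial σ ℂ),
    R.totalDegree ≤ d ∧ (∀ k, (Q k).totalDegree + 1 ≤ d) ∧ p = R + ∑ k, X k.1 * X k.2 * Q k)
    ?_ ⟨0, 0, by simp, fun _ => by simpa using hd, by simp⟩ ?_
  · rintro _ _ ⟨R, Q, hR, hQ, rfl⟩ ⟨R', Q', hR', hQ', rfl⟩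
    refine ⟨R + R', Q + Q', (totalDegree_add _ _).trans (max_le hR hR'), fun k => ?_, ?_⟩
    · have := totalDegree_add (Q k) (Q' k)
      have h1 := hQ k
      have h2 := hQ' k
      simp only [Pi.add_apply]
      omega
    · simp only [Pi.add_apply, mul_add, Finset.sum_add_distrib]
      ring
  · intro s hs
    have hs' : s.degree ≤ d + 1 := (le_totalDegree hs).trans hp
    by_cases hsd : s.degree ≤ d
    · exact ⟨monomial s (coeff s p), 0, (totalDegree_monomial_le _ _).trans hsd,
        fun _ => by simpa using hd, by simp⟩
    · have split (t : σ →₀ ℕ) (ht : t.degree ≠ 0) :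
          ∃ j u, t = Finsupp.single j 1 + u ∧ t.degree = u.degree + 1 := by
        obtain ⟨j, hj⟩ : ∃ j, t j ≠ 0 := by
          by_contra! h
          exact ht (by rw [show t = 0 from Finsupp.ext h]; simp)
        have hle : Finsupp.single j 1 ≤ t := by
          rw [Finsupp.single_le_iff]; omega
        have h1 : t = Finsupp.single j 1 + (t - Finsupp.single j 1) :=
          (add_tsub_cancel_of_le hle).symm
        refine ⟨j, _, h1, ?_⟩
        conv_lhs => rw [h1]
        simp [map_add, add_comm]
      obtain ⟨j, u, rfl, hu⟩ := split s (by omega)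
      obtain ⟨l, v, rfl, hv⟩ := split u (by omega)
      refine ⟨0, Pi.single (j, l) (monomial v (coeff (Finsupp.single j 1 + (Finsupp.single l 1 + v)) p)), by simp, fun k => ?_, ?_⟩
      · rcases eq_or_ne k (j, l) with rfl | hk
        · rw [Pi.single_eq_same]
          have := totalDegree_monomial_le v (coeff (Finsupp.single j 1 + (Finsupp.single l 1 + v)) p)
          change _ ≤ v.degree at this
          omega
        · rw [Pi.single_eq_of_ne hk]
          simpa using hd
      · rw [zero_add, Finset.sum_eq_single (j, l)]
        · simp [X, monomial_mul, add_assoc]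
        · intro k _ hk
          simp [Pi.single_eq_of_ne hk]
        · simp

/-- With new variables `u` for the products `x x'` and `v` for the cofactors `Q`, subtracting `(u +
x x') * (v + Q)` cancels `x x' Q`. What remains is `u v`, `u Q` and the cubic `x x' v`; the last is
why `3 ≤ d` is needed. -/
theorem IsNoninjectiveKeller.exists_totalDegree_le [Fintype σ] [DecidableEq σ] {d : ℕ}
    (hd : 3 ≤ d) {F : σ → MvPolynomial σ ℂ} (hF : IsNoninjectiveKeller F)
    (hdeg : ∀ i, (F i).totalDegree ≤ d + 1) :
    ∃ (τ : Type) (_ : Fintype τ) (_ : DecidableEq τ) (G : τ → MvPolynomial τ ℂ),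
      IsNoninjectiveKeller G ∧ ∀ i, (G i).totalDegree ≤ d := by
  choose R Q hR hQ hF' using fun i => exists_eq_add_sum_X_mul_X_mul (d := d) (by omega) (F i) (hdeg i)
  let S : (σ × σ) ⊕ (σ × (σ × σ)) → MvPolynomial σ ℂ :=
    Sum.elim (fun k => X k.1 * X k.2) (fun k => Q k.1 k.2)
  let q : σ → MvPolynomial ((σ × σ) ⊕ (σ × (σ × σ))) ℂ :=
    fun i => ∑ k, X (Sum.inl k) * X (Sum.inr (i, k))
  refine ⟨_, _, _, _, hF.elementaryExtension S q, ?_⟩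
  have hXX (k : σ × σ) : (X k.1 * X k.2 : MvPolynomial σ ℂ).totalDegree ≤ 2 :=
    (totalDegree_mul _ _).trans (by simp)
  have hren (p : MvPolynomial σ ℂ) := totalDegree_rename_le
    (Sum.inl : σ → σ ⊕ ((σ × σ) ⊕ (σ × (σ × σ)))) p
  rintro (i | k | k)
  · have : _root_.elementaryExtension F S q (Sum.inl i) = rename Sum.inl (R i) -
        ∑ k, (X (Sum.inr (Sum.inl k)) * X (Sum.inr (Sum.inr (i, k))) +
          X (Sum.inr (Sum.inl k)) * rename Sum.inl (Q i k) +
          rename Sum.inl (X k.1 * X k.2) * X (Sum.inr (Sum.inr (i, k)))) := by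
      simp only [_root_.elementaryExtension, Sum.elim_inl, q, map_sum, map_mul, bind₁_X_right, S,
        Sum.elim_inr]
      conv_lhs => rw [hF' i]
      simp only [map_add, map_sum, map_mul, rename_X]
      rw [add_sub_assoc, ← Finset.sum_sub_distrib, sub_eq_add_neg, ← Finset.sum_neg_distrib]
      congr 1
      exact Finset.sum_congr rfl fun k _ => by ring
    rw [this]
    refine (totalDegree_sub _ _).trans (max_le ((hren _).trans (hR i)) ?_)
    refine totalDegree_finsetSum_le fun k _ => ?_
    refine (totalDegree_add _ _).trans (max_le ((totalDegree_add _ _).trans (max_le ?_ ?_)) ?_)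
    · refine (totalDegree_mul _ _).trans ?_
      simp only [totalDegree_X]
      omega
    · refine (totalDegree_mul _ _).trans ?_
      have := hren (Q i k)
      have := hQ i k
      simp only [totalDegree_X]
      omega
    · refine (totalDegree_mul _ _).trans ?_
      have := hren (X k.1 * X k.2)
      have := hXX k
      simp only [totalDegree_X]
      omega
  · refine (totalDegree_add _ _).trans (max_le (by simp; omega) ?_)
    have := hXX k
    exact (hren _).trans (this.trans (by omega))
  · refine (totalDegree_add _ _).trans (max_le (by simp; omega) ?_)
    have := hQ k.1 k.2
    exact (hren _).trans (show (Q k.1 k.2).totalDegree ≤ d by omega)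

theorem IsNoninjectiveKeller.exists_totalDegree_le_three [Fintype σ] [DecidableEq σ] (d : ℕ)
    {F : σ → MvPolynomial σ ℂ} (hF : IsNoninjectiveKeller F)
    (hdeg : ∀ i, (F i).totalDegree ≤ d + 3) :
    ∃ (τ : Type) (_ : Fintype τ) (_ : DecidableEq τ) (G : τ → MvPolynomial τ ℂ),
      IsNoninjectiveKeller G ∧ ∀ i, (G i).totalDegree ≤ 3 := by
  induction d generalizing σ with
  | zero => exact ⟨σ, _, _, F, hF, hdeg⟩
  | succ d ih =>
    obtain ⟨τ, _, _, G, hG, hGd⟩ :=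
      hF.exists_totalDegree_le (d := d + 3) (by omega) fun i => (hdeg i).trans (by omega)
    exact ih hG hGd

/-- The degree of a noninjective Keller map of degree at most `3` can be made exactly `3`. -/
theorem IsNoninjectiveKeller.exists_homogeneousComponent_three_ne_zero [Fintype σ]
    [DecidableEq σ] {F : σ → MvPolynomial σ ℂ} (hF : IsNoninjectiveKeller F)
    (hdeg : ∀ i, (F i).totalDegree ≤ 3) :
    ∃ (τ : Type) (_ : Fintype τ) (_ : DecidableEq τ) (G : τ → MvPolynomial τ ℂ),
      IsNoninjectiveKeller G ∧ (∀ i, (G i).totalDegree ≤ 3) ∧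
        ∃ i, homogeneousComponent 3 (G i) ≠ 0 := by
  obtain ⟨j⟩ : Nonempty σ := by
    obtain ⟨-, a, b, hab, -⟩ := hF
    obtain ⟨j, -⟩ := Function.ne_iff.mp hab
    exact ⟨j⟩
  -- One extra variable `w` with coordinate `w + x_j ^ 3` supplies the cubic term.
  refine ⟨_, _, _, _, hF.elementaryExtension (fun _ : Unit => X j ^ 3) 0, ?_, Sum.inr (), ?_⟩
  · rintro (i | k)
    · simpa [_root_.elementaryExtension] using (totalDegree_rename_le _ _).trans (hdeg i)
    · refine (totalDegree_add _ _).trans (max_le (by simp) ?_)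
      exact (totalDegree_rename_le _ _).trans (by simp)
  · have h1 : homogeneousComponent 3 (X (Sum.inr ()) : MvPolynomial (σ ⊕ Unit) ℂ) = 0 :=
      homogeneousComponent_eq_zero _ _ (by simp)
    have h2 : homogeneousComponent 3 (X (Sum.inl j) ^ 3 : MvPolynomial (σ ⊕ Unit) ℂ)
        = X (Sum.inl j) ^ 3 := homogeneousComponent_eq_self (isHomogeneous_X_pow _ 3)
    simp [_root_.elementaryExtension, h1, h2]

/-! ### Homogeneity, nilpotency and normalisation of the linear part. -/

theorem MvPolynomial.IsHomogeneous.eval_smul_eq [Fintype σ] {p : MvPolynomial σ ℂ} {n : ℕ}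
    (hp : p.IsHomogeneous n) (c : ℂ) (x : σ → ℂ) : eval (c • x) p = c ^ n * eval x p := by
  rw [eval_eq', eval_eq', Finset.mul_sum]
  refine Finset.sum_congr rfl fun d hd => ?_
  have hdeg : ∑ i, d i = n := by
    have := hp (mem_support_iff.mp hd)
    rwa [Pi.one_def, ← Finsupp.degree_eq_weight_one, Finsupp.degree_eq_sum] at this
  simp only [Pi.smul_apply, smul_eq_mul, mul_pow, Finset.prod_mul_distrib,
    Finset.prod_pow_eq_pow_sum, hdeg]
  ring

/-- A polynomial matrix is nilpotent if its specialisations have characteristic polynomial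
`X ^ n` away from the origin. -/
theorem pow_card_eq_zero_of_det_eval [Fintype ι] [DecidableEq ι]
    (A : Matrix ι ι (MvPolynomial σ ℂ))
    (h : ∀ x : σ → ℂ, ∀ c : ℂ, c ≠ 0 →
      (Matrix.scalar ι c - A.map (eval x)).det = c ^ Fintype.card ι) :
    A ^ Fintype.card ι = 0 := by
  have hx (x : σ → ℂ) : (A.map (eval x)) ^ Fintype.card ι = 0 := by
    have hchar : (A.map (eval x)).charpoly = Polynomial.X ^ Fintype.card ι := by
      refine Polynomial.eq_of_infinite_eval_eq _ _
        (((Set.finite_singleton (0 : ℂ)).infinite_compl).mono fun c hc => ?_)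
      simp only [Set.mem_ofPred_eq, Matrix.eval_charpoly, Polynomial.eval_pow, Polynomial.eval_X]
      exact h x c hc
    simpa [hchar] using Matrix.aeval_self_charpoly (A.map (eval x))
  ext1 i j
  refine MvPolynomial.funext fun x => ?_
  have h1 := congrFun (congrFun (hx x) i) j
  rw [show A.map (eval x) = (eval x).mapMatrix A from rfl, ← map_pow] at h1
  simpa using h1

/-- A noninjective Keller map may be normalised to have the identity as its linear part. -/
theorem IsNoninjectiveKeller.exists_homogeneousComponent_one_eq_X [Fintype σ] [DecidableEq σ]
    {F : σ → MvPolynomial σ ℂ} (hF : IsNoninjectiveKeller F)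
    (hdeg : ∀ i, (F i).totalDegree ≤ 3) (hthree : ∃ i, homogeneousComponent 3 (F i) ≠ 0) :
    ∃ G : σ → MvPolynomial σ ℂ, IsNoninjectiveKeller G ∧ (∀ i, (G i).totalDegree ≤ 3) ∧
      (∃ i, homogeneousComponent 3 (G i) ≠ 0) ∧ ∀ i, homogeneousComponent 1 (G i) = X i := by
  obtain ⟨hdet, a, b, hab, h⟩ := hF
  set J : Matrix σ σ ℂ := (eval 0).mapMatrix (polyJacobian F) with hJ
  have hJdet : J.det = 1 := by rw [hJ, ← RingHom.map_det, hdet, map_one]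
  have hunit : IsUnit J.det := by rw [hJdet]; exact isUnit_one
  set M := J⁻¹ with hM
  have hMJ : M * J = 1 := Matrix.nonsing_inv_mul J hunit
  have hJM : J * M = 1 := Matrix.mul_nonsing_inv J hunit
  let G : σ → MvPolynomial σ ℂ := fun i => ∑ j, C (M i j) * F j
  have hGJ : polyJacobian G = C.mapMatrix M * polyJacobian F := by
    ext1 i j
    simp [polyJacobian, G, Matrix.mul_apply]
  have hMdet : M.det = 1 := by
    have := congrArg Matrix.det hMJ
    rwa [Matrix.det_mul, hJdet, mul_one, Matrix.det_one] at this
  have hcomp (k : ℕ) (i : σ) : homogeneousComponent k (G i) =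
      ∑ j, C (M i j) * homogeneousComponent k (F j) := by
    simp [G, map_sum, homogeneousComponent_C_mul]
  refine ⟨G, ⟨?_, a, b, hab, fun i => ?_⟩, fun i => ?_, ?_, fun i => ?_⟩
  · rw [hGJ, Matrix.det_mul, ← RingHom.map_det, hMdet, hdet, map_one, mul_one]
  · simp [G, h]
  · refine totalDegree_finsetSum_le fun j _ => (totalDegree_mul _ _).trans ?_
    simpa using hdeg j
  -- `J` undoes `M`, so the cubic parts of `F` are combinations of those of `G`.
  · by_contra! hzero
    obtain ⟨i, hi⟩ := hthree
    refine hi ?_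
    calc homogeneousComponent 3 (F i)
        = ∑ j, C ((J * M) i j) * homogeneousComponent 3 (F j) := by
          rw [hJM, Finset.sum_eq_single i]
          · simp
          · intro j _ hj
            simp [Matrix.one_apply_ne hj.symm]
          · simp
      _ = ∑ l, C (J i l) * homogeneousComponent 3 (G l) := by
          simp only [hcomp, Matrix.mul_apply, map_sum, map_mul, Finset.sum_mul, Finset.mul_sum]
          rw [Finset.sum_comm]
          exact Finset.sum_congr rfl fun _ _ => Finset.sum_congr rfl fun _ _ => by ring
      _ = 0 := by simp [hzero]
  · have hlin (j : σ) : coeff (Finsupp.single j 1) (G i) = (1 : Matrix σ σ ℂ) i j := by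
      have h1 : eval 0 (pderiv j (G i)) = (1 : Matrix σ σ ℂ) i j := by
        rw [← hMJ]
        have := congrArg (fun A => eval 0 (A i j)) hGJ
        simpa [polyJacobian, Matrix.mul_apply, hJ] using this
      rw [← h1, eval_zero, constantCoeff_eq, coeff_pderiv]
      simp
    ext d
    rw [coeff_homogeneousComponent, coeff_X]
    split_ifs with hd hi hi
    · rw [← hi, hlin, Matrix.one_apply_eq]
    · obtain ⟨j, rfl⟩ : d ∈ Set.range fun j : σ => Finsupp.single j 1 := by
        rw [Finsupp.range_single_one]
        exact hd
      rw [hlin, Matrix.one_apply_ne]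
      rintro rfl
      exact hi rfl
    · subst hi
      simp at hd
    · rfl

theorem MvPolynomial.eq_sum_homogeneousComponent_of_totalDegree_le_three {p : MvPolynomial σ ℂ}
    (hp : p.totalDegree ≤ 3) :
    p = C (coeff 0 p) + homogeneousComponent 1 p + homogeneousComponent 2 p +
      homogeneousComponent 3 p := by
  have h : ∑ i ∈ Finset.range 4, homogeneousComponent i p = p := by
    conv_rhs => rw [← sum_homogeneousComponent p]
    refine (Finset.sum_subset (Finset.range_subset_range.mpr (by omega)) fun k _ hk => ?_).symm
    exact homogeneousComponent_eq_zero _ _ (by simpa using hk)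
  conv_lhs => rw [← h]
  simp [Finset.sum_range_succ]

/-! ### The cubic nilpotent map. -/

/-- The map `(x, y) ↦ (y - G₂ x + c, -G₃ x)`, where `Gₖ` is the homogeneous part of degree `k`
of `G`. -/
noncomputable def quasihomogeneousMap (G : σ → MvPolynomial σ ℂ) (c : σ → ℂ) :
    σ ⊕ σ → MvPolynomial (σ ⊕ σ) ℂ :=
  Sum.elim
    (fun i => X (Sum.inr i) - rename Sum.inl (homogeneousComponent 2 (G i)) + C (c i))
    (fun i => -rename Sum.inl (homogeneousComponent 3 (G i)))

/-- Since `J 2` and `J 3` are homogeneous of degrees 1 and 2, the Schur complement `t + J 2 x + t⁻¹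
J 3 x` is `t` times the Jacobi matrix of `G` at `t⁻¹ x`, which has determinant 1. -/
theorem polyJacobian_quasihomogeneousMap_pow [Fintype σ] [DecidableEq σ]
    {G : σ → MvPolynomial σ ℂ} (hdet : (polyJacobian G).det = 1)
    (hdeg : ∀ i, (G i).totalDegree ≤ 3) (hone : ∀ i, homogeneousComponent 1 (G i) = X i)
    (c : σ → ℂ) :
    polyJacobian (quasihomogeneousMap G c) ^ Fintype.card (σ ⊕ σ) = 0 := by
  refine pow_card_eq_zero_of_det_eval _ fun z t ht => ?_
  let J (k : ℕ) (x : σ → ℂ) : Matrix σ σ ℂ :=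
    Matrix.of fun i j => eval x (pderiv j (homogeneousComponent k (G i)))
  have hJ (k : ℕ) (s : ℂ) (x : σ → ℂ) : J k (s • x) = s ^ (k - 1) • J k x := by
    ext1 i j
    exact (homogeneousComponent_isHomogeneous k (G i)).pderiv.eval_smul_eq s x
  have hG (x : σ → ℂ) : (1 + J 2 x + J 3 x).det = 1 := by
    have h1 := congrArg (eval x) hdet
    rw [map_one, RingHom.map_det] at h1
    rw [← h1]
    congr 1
    ext1 i j
    simp only [RingHom.mapMatrix_apply, Matrix.map_apply, polyJacobian, Matrix.of_apply]
    conv_rhs => rw [eq_sum_homogeneousComponent_of_totalDegree_le_three (hdeg i)]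
    simp [J, hone, pderiv_X, Matrix.one_apply, Pi.single_apply]
  set x : σ → ℂ := z ∘ Sum.inl with hx
  have hblock : Matrix.scalar (σ ⊕ σ) t - (polyJacobian (quasihomogeneousMap G c)).map (eval z) =
      Matrix.fromBlocks (t • 1 + J 2 x) (-1) (J 3 x) (t • 1) := by
    ext1 i j
    rcases i with i | i <;> rcases j with j | j <;>
    simp [polyJacobian, quasihomogeneousMap, J, pderiv_inl_rename_inl, pderiv_inr_rename_inl,
      pderiv_X, Pi.single_apply, Matrix.one_apply, Matrix.diagonal_apply, eval_rename, hx]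
  let _ : Invertible (t • (1 : Matrix σ σ ℂ)) :=
    ⟨t⁻¹ • 1, by simp [ht], by simp [ht]⟩
  have hinv : ⅟(t • (1 : Matrix σ σ ℂ)) = t⁻¹ • 1 := rfl
  have hfactor : t • (1 : Matrix σ σ ℂ) + J 2 x - (-1) * (t⁻¹ • 1) * J 3 x =
      t • (1 + J 2 (t⁻¹ • x) + J 3 (t⁻¹ • x)) := by
    rw [hJ, hJ]
    ext1 i j
    simp
    field_simp
  rw [hblock, Matrix.det_fromBlocks₂₂, hinv, hfactor, Matrix.det_smul, Matrix.det_smul, hG,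
    Matrix.det_one, Fintype.card_sum, pow_add]
  ring

theorem sup_totalDegree_quasihomogeneousMap [Fintype σ] {G : σ → MvPolynomial σ ℂ}
    (hthree : ∃ i, homogeneousComponent 3 (G i) ≠ 0) (c : σ → ℂ) :
    (Finset.univ.sup fun i => (quasihomogeneousMap G c i).totalDegree) = 3 := by
  refine le_antisymm (Finset.sup_le ?_) ?_
  · rintro (i | i) -
    · refine (totalDegree_add _ _).trans (max_le ((totalDegree_sub _ _).trans (max_le ?_ ?_)) ?_)
      · simp
      · exact (totalDegree_rename_le _ _).trans
          ((homogeneousComponent_isHomogeneous 2 (G i)).totalDegree_le.trans (by norm_num))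
      · simp
    · rw [quasihomogeneousMap, Sum.elim_inr, totalDegree_neg]
      exact (totalDegree_rename_le _ _).trans
        (homogeneousComponent_isHomogeneous 3 (G i)).totalDegree_le
  · obtain ⟨i, hi⟩ := hthree
    refine le_trans (le_of_eq ?_)
      (Finset.le_sup (f := fun i => (quasihomogeneousMap G c i).totalDegree)
        (Finset.mem_univ (Sum.inr i)))
    simp only [quasihomogeneousMap, Sum.elim_inr, totalDegree_neg]
    refine ((homogeneousComponent_isHomogeneous 3 (G i)).rename_isHomogeneous.totalDegree ?_).symm
    rwa [Ne, rename_eq_zero_iff_of_injective _ Sum.inl_injective]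

/-- A noninjective Keller map gives rise to a cubic map with nilpotent Jacobi matrix and two
fixed points. -/
theorem IsNoninjectiveKeller.exists_cubic_nilpotent [Fintype σ] [DecidableEq σ]
    {F : σ → MvPolynomial σ ℂ} (hF : IsNoninjectiveKeller F) :
    ∃ (τ : Type) (_ : Fintype τ) (_ : DecidableEq τ) (N : τ → MvPolynomial τ ℂ),
      polyJacobian N ^ Fintype.card τ = 0 ∧ (Finset.univ.sup fun i => (N i).totalDegree) = 3 ∧
        ∃ a b : τ → ℂ, a ≠ b ∧ (∀ i, eval a (N i) = a i) ∧ ∀ i, eval b (N i) = b i := by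
  obtain ⟨τ₁, _, _, F₁, hF₁, hd₁⟩ := hF.exists_totalDegree_le_three
    (Finset.univ.sup fun i => (F i).totalDegree)
    fun i => (Finset.le_sup (f := fun i => (F i).totalDegree) (Finset.mem_univ i)).trans
      (Nat.le_add_right _ _)
  obtain ⟨τ, _, _, F₂, hF₂, hd₂, ht₂⟩ := hF₁.exists_homogeneousComponent_three_ne_zero hd₁
  obtain ⟨G, ⟨hdet, a, b, hab, h⟩, hd, ht, hone⟩ :=
    hF₂.exists_homogeneousComponent_one_eq_X hd₂ ht₂
  -- With this `c`, the fixed points lie over the fibre of `G` through `a`, which contains `b`.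
  let c : τ → ℂ := fun i => eval a (G i) - coeff 0 (G i)
  let y (x : τ → ℂ) : τ → ℂ := fun i => -eval x (homogeneousComponent 3 (G i))
  have hfix (x : τ → ℂ) (hx : ∀ i, eval a (G i) = eval x (G i)) (i : τ ⊕ τ) :
      eval (Sum.elim x (y x)) (quasihomogeneousMap G c i) = Sum.elim x (y x) i := by
    rcases i with i | i
    · have h1 := congrArg (eval x) (eq_sum_homogeneousComponent_of_totalDegree_le_three (hd i))
      rw [hone, ← hx] at h1
      simp only [map_add, eval_C, eval_X] at h1
      simp only [quasihomogeneousMap, Sum.elim_inl, Sum.elim_inr, map_add, map_sub, eval_X,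
        eval_C, eval_rename, Sum.elim_comp_inl, y, c]
      rw [h1]
      ring
    · simp [quasihomogeneousMap, eval_rename, Sum.elim_comp_inl, y]
  refine ⟨τ ⊕ τ, _, _, quasihomogeneousMap G c,
    polyJacobian_quasihomogeneousMap_pow hdet hd hone c, sup_totalDegree_quasihomogeneousMap ht c,
    Sum.elim a (y a), Sum.elim b (y b), fun hne => hab ?_, hfix a fun _ => rfl, hfix b h⟩
  funext i
  exact congrFun hne (Sum.inl i)

/-! ### Transfer to `Fin n` and conclusion. -/

/-- Reindexing of the coordinates of a polynomial map. -/
noncomputable def reindexPolyMap (e : σ ≃ ι) (N : σ → MvPolynomial σ ℂ) :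
    ι → MvPolynomial ι ℂ :=
  fun i => rename e (N (e.symm i))

theorem polyJacobian_reindexPolyMap [Fintype σ] [DecidableEq σ] [Fintype ι] [DecidableEq ι]
    (e : σ ≃ ι) (N : σ → MvPolynomial σ ℂ) :
    polyJacobian (reindexPolyMap e N) =
      Matrix.reindexAlgEquiv ℂ _ e ((rename e : MvPolynomial σ ℂ →ₐ[ℂ] _).toRingHom.mapMatrix
        (polyJacobian N)) := by
  ext1 i j
  obtain ⟨j, rfl⟩ := e.surjective j
  simp [polyJacobian, reindexPolyMap, pderiv_rename e.injective]

end PolynomialMaps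

theorem AffineMorphism.det_polyJacobian_X_sub {n : ℕ} {N : AffineMorphism n}
    (hN : N.IsNilpotentMorphism) : (polyJacobian fun i => X i - N i).det = 1 := by
  have hJ : polyJacobian (fun i => X i - N i) = 1 - N.jacobian := by
    ext1 i j
    simp [polyJacobian, AffineMorphism.jacobian, pderiv_X, Matrix.one_apply, Pi.single_apply]
  -- The difference of the two sides is nilpotent in a reduced ring; evaluating at 1 then gives the
  -- determinant.
  have hchar : N.jacobian.charpoly = Polynomial.X ^ n := by
    have := (Matrix.isNilpotent_charpoly_sub_pow_of_isNilpotent ⟨n, hN⟩).eq_zero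
    rwa [Fintype.card_fin, sub_eq_zero] at this
  have := Matrix.eval_charpoly N.jacobian 1
  rw [hchar, Polynomial.eval_pow, Polynomial.eval_X, one_pow, map_one] at this
  rw [hJ, ← this]

theorem mainTheorem6
    (h : ∀ (m : ℕ) (N : AffineMorphism m), N.IsNilpotentMorphism → N.polyDegree = 3 →
      ∃! x : Fin m → ℂ, Function.IsFixedPt N.toMap x) :
    ∀ n : ℕ, ConjectureJN n := by
  intro n N hN a ha b hb
  by_contra hab
  have hfix {x : Fin n → ℂ} (hx : x ∈ Function.fixedPoints N.toMap) (i : Fin n) :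
      eval x (X i - N i) = 0 := by
    rw [map_sub, eval_X, sub_eq_zero]
    exact (congrFun hx i).symm
  have hF : IsNoninjectiveKeller fun i => X i - N i :=
    ⟨AffineMorphism.det_polyJacobian_X_sub hN, a, b, hab, fun i => by rw [hfix ha, hfix hb]⟩
  obtain ⟨τ, _, _, P, hP, hdeg, x, y, hxy, hx, hy⟩ := hF.exists_cubic_nilpotent
  let e := Fintype.equivFin τ
  have hnil : AffineMorphism.IsNilpotentMorphism (reindexPolyMap e P) := by
    change polyJacobian (reindexPolyMap e P) ^ _ = 0
    rw [polyJacobian_reindexPolyMap, ← map_pow, ← map_pow, hP,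
      map_zero, map_zero]
  have hthree : AffineMorphism.polyDegree (reindexPolyMap e P) = 3 := by
    rw [← hdeg, AffineMorphism.polyDegree, ← Finset.univ_map_equiv_to_embedding e,
      Finset.sup_map]
    refine Finset.sup_congr rfl fun i _ => ?_
    simp [reindexPolyMap, ← renameEquiv_apply, totalDegree_renameEquiv]
  have hfixed {z : τ → ℂ} (hz : ∀ i, eval z (P i) = z i) :
      Function.IsFixedPt (AffineMorphism.toMap (reindexPolyMap e P)) (z ∘ e.symm) := by
    funext i
    simp [AffineMorphism.toMap, reindexPolyMap, eval_rename, Function.comp_assoc, hz]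
  have heq := (h _ _ hnil hthree).unique (hfixed hx) (hfixed hy)
  exact hxy (e.symm.surjective.injective_comp_right heq)
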